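/- **Setting.** Terms and atoms are first-order over a fixed signature and an infinite set of variables. A query is a finite sequence of atoms, a clause $H\gets Q$ consists of an atom $H$ and a query $Q$, and a program is a set of clauses. A moding declares each argument position of each predicate symbol to be input or output. A query $Q=A_1,\dots,A_n$ is *output linear* if no variable occurs more than once in the output positions of $Q$; an atom is *input linear* if no variable occurs more than once in its input positions. Write $A_i\to_Q A_j$ if some variable occurs in an output position of $A_i$ and in an input position of $A_j$. The query $Q$ is *tidy* if it is output linear and $\to_Q$ is acyclic. A clause $H\gets Q$ is *tidy* if $Q$ is tidy, $H$ is input linear, and no variable from an input position of $H$ occurs in an output position of $Q$. A program is tidy if all its clauses are. A finite set $E$ of equations is *NSTO* if no execution of the nondeterministic Martelli–Montanari unification algorithm starting with $E$ performs the action "halt with failure on an equation $X\doteq t$ with $X\in\mathrm{Var}(t)$, $X\neq t$" (a successful occur-check). The unification of $A$ and $H$ is *available* in an SLD-derivation or SLD-tree for a program $P$ if $A$ is the selected atom of one of its queries, $H$ is the head of a standardized apart variant of a clause of $P$, and $A$, $H$ have the same predicate symbol. (Standardized apart: sharing no variable with the initial query or with the mgus and input clauses of the earlier steps.) $P$ with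 a query $Q$ is *occur-check free* under a selection rule if $\{A\doteq H\}$ is NSTO for all unifications of $A$ and $H$ available in SLD-trees (equivalently, in SLD-derivations) for $P$ with $Q$ under this rule. A selection rule chooses an atom of the last query of an initial fragment of a derivation, depending on the whole fragment; it may be partial, i.e. choose no atom. **Theorem.** Fix a moding. 1. If $P$ is a tidy program and $Q$ a tidy query, then $P$ with $Q$ is occur-check free under every selection rule. 2. If $Q$ is a tidy query and $C$ a tidy clause, then every SLD-resolvent of $Q$ and $C$ is tidy. (An SLD-resolvent is formed by selecting an arbitrary atom $A$ of $Q$, taking a variant $H\gets\vec B$ of $C$ that is variable disjoint from $Q$ and an arbitrary mgu $\theta$ of $A$ and $H$, replacing $A$ by $\vec B$ in $Q$, and applying $\theta$.) -/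

import Mathlib

namespace LP

universe u v w

/-! ### Atoms, queries, clauses, programs

Terms are Mathlib's first-order terms `L.Term V` over the function symbols of `L`, with variables
in `V`; the relation symbols of `L` are the predicate symbols. -/

/-- An atom `p(t₁, …, tₙ)`. -/
structure Atom (L : FirstOrder.Language.{u, v}) (V : Type w) where
  arity : ℕ
  pred : L.Relations arity
  args : Fin arity → L.Term V

/-- A query is a finite sequence of atoms. -/
abbrev Query (L : FirstOrder.Language.{u, v}) (V : Type w) := List (Atom L V)

/-- A clause `head ← body`. -/
structure Clause (L : FirstOrder.Language.{u, v}) (V : Type w) where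
  head : Atom L V
  body : Query L V

/-- A program is a set of clauses (finiteness is not needed). -/
abbrev Program (L : FirstOrder.Language.{u, v}) (V : Type w) := Set (Clause L V)

variable {L : FirstOrder.Language.{u, v}} {V : Type w}

/-- The variable occurrences of a term, from left to right, with repetitions. -/
def termOccs : L.Term V → List V
  | .var x => [x]
  | .func _ ts => (List.ofFn fun i => termOccs (ts i)).flatten

/-- The set `Var(t)`. -/
def termVars (t : L.Term V) : Set V := {x | x ∈ termOccs t}

def Atom.vars (A : Atom L V) : Set V := {x | ∃ i, x ∈ termVars (A.args i)}

def Query.vars (Q : Query L V) : Set V := {x | ∃ A ∈ Q, x ∈ A.vars}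

def Clause.vars (C : Clause L V) : Set V := C.head.vars ∪ Query.vars C.body

/-! ### Substitutions -/

/-- A substitution: a map from variables to terms which moves only finitely many variables. -/
structure Subst (L : FirstOrder.Language.{u, v}) (V : Type w) where
  toFun : V → L.Term V
  finite_dom : {x | toFun x ≠ .var x}.Finite

def Subst.dom (θ : Subst L V) : Set V := {x | θ.toFun x ≠ .var x}

def Subst.ran (θ : Subst L V) : Set V := {y | ∃ x ∈ θ.dom, y ∈ termVars (θ.toFun x)}

/-- `Var(θ)`: all variables occurring in `θ = {X₁/t₁, …, Xₙ/tₙ}`. -/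
def Subst.vars (θ : Subst L V) : Set V := θ.dom ∪ θ.ran

def Atom.subst (A : Atom L V) (f : V → L.Term V) : Atom L V :=
  ⟨A.arity, A.pred, fun i => (A.args i).subst f⟩

def Query.subst (Q : Query L V) (f : V → L.Term V) : Query L V :=
  Q.map fun A => A.subst f

def Clause.subst (C : Clause L V) (f : V → L.Term V) : Clause L V :=
  ⟨C.head.subst f, Query.subst C.body f⟩

/-- A renaming: a substitution that permutes the variables. -/
def Subst.IsRenaming (γ : Subst L V) : Prop :=
  ∃ π : Equiv.Perm V, ∀ x, γ.toFun x = .var (π x)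

/-- `C'` is a variant of `C`. -/
def Clause.IsVariant (C' C : Clause L V) : Prop :=
  ∃ γ : Subst L V, γ.IsRenaming ∧ C' = C.subst γ.toFun

def Subst.Unifies (θ : Subst L V) (A H : Atom L V) : Prop :=
  A.subst θ.toFun = H.subst θ.toFun

/-- `θ` is a most general unifier of `A` and `H`: it unifies them and every unifier `η` is of the
form `θγ`. (It need be neither relevant nor idempotent.) -/
def Subst.IsMGU (θ : Subst L V) (A H : Atom L V) : Prop :=
  θ.Unifies A H ∧
    ∀ η : Subst L V, η.Unifies A H →
      ∃ γ : Subst L V, ∀ x, η.toFun x = (θ.toFun x).subst γ.toFun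

/-! ### The Martelli-Montanari algorithm and NSTO -/

/-- An equation between two terms or between two atoms. -/
inductive Equation (L : FirstOrder.Language.{u, v}) (V : Type w)
  | term (s t : L.Term V)
  | atom (A B : Atom L V)

def Equation.vars : Equation L V → Set V
  | .term s t => termVars s ∪ termVars t
  | .atom A B => A.vars ∪ B.vars

def Equation.subst (f : V → L.Term V) : Equation L V → Equation L V
  | .term s t => .term (s.subst f) (t.subst f)
  | .atom A B => .atom (A.subst f) (B.subst f)

open Classical in
/-- The map of the substitution `{X/t}`. -/
noncomputable def singleSubst (X : V) (t : L.Term V) : V → L.Term V :=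
  fun y => if y = X then t else .var y

/-- A configuration of the algorithm: a current equation set, or a halt with failure, either by a
clash of symbols (action 2) or by a successful occur-check (action 6). -/
inductive MMConfig (L : FirstOrder.Language.{u, v}) (V : Type w)
  | eqs (E : Set (Equation L V))
  | clash
  | occurCheck

/-- The actions (1)-(6) of the Martelli-Montanari algorithm; an equation from the current set is
chosen nondeterministically. Actions (1) and (2) concern function symbols and predicate symbols. -/
inductive MMStep : MMConfig L V → MMConfig L V → Prop
  | decompose_term {E : Set (Equation L V)} {n : ℕ} (f : L.Functions n) (s t : Fin n → L.Term V)
      (h : Equation.term (.func f s) (.func f t) ∈ E) :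
      MMStep (.eqs E) (.eqs ((E \ {Equation.term (.func f s) (.func f t)}) ∪
        Set.range fun i => Equation.term (s i) (t i)))
  | decompose_atom {E : Set (Equation L V)} {n : ℕ} (p : L.Relations n) (s t : Fin n → L.Term V)
      (h : Equation.atom ⟨n, p, s⟩ ⟨n, p, t⟩ ∈ E) :
      MMStep (.eqs E) (.eqs ((E \ {Equation.atom ⟨n, p, s⟩ ⟨n, p, t⟩}) ∪
        Set.range fun i => Equation.term (s i) (t i)))
  | clash_term {E : Set (Equation L V)} {n m : ℕ} (f : L.Functions n) (g : L.Functions m)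
      (s : Fin n → L.Term V) (t : Fin m → L.Term V)
      (hfg : (⟨n, f⟩ : Σ k, L.Functions k) ≠ ⟨m, g⟩)
      (h : Equation.term (.func f s) (.func g t) ∈ E) :
      MMStep (.eqs E) .clash
  | clash_atom {E : Set (Equation L V)} (A B : Atom L V)
      (hAB : (⟨A.arity, A.pred⟩ : Σ k, L.Relations k) ≠ ⟨B.arity, B.pred⟩)
      (h : Equation.atom A B ∈ E) :
      MMStep (.eqs E) .clash
  | delete {E : Set (Equation L V)} (X : V) (h : Equation.term (.var X) (.var X) ∈ E) :
      MMStep (.eqs E) (.eqs (E \ {Equation.term (.var X) (.var X)}))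
  | swap {E : Set (Equation L V)} (X : V) (t : L.Term V) (ht : ∀ Y, t ≠ .var Y)
      (h : Equation.term t (.var X) ∈ E) :
      MMStep (.eqs E) (.eqs ((E \ {Equation.term t (.var X)}) ∪ {Equation.term (.var X) t}))
  | eliminate {E : Set (Equation L V)} (X : V) (t : L.Term V) (hX : X ∉ termVars t)
      (h : Equation.term (.var X) t ∈ E)
      (helse : ∃ e ∈ E \ {Equation.term (.var X) t}, X ∈ e.vars) :
      MMStep (.eqs E) (.eqs ({Equation.term (.var X) t} ∪
        Equation.subst (singleSubst X t) '' (E \ {Equation.term (.var X) t})))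
  | occur_check {E : Set (Equation L V)} (X : V) (t : L.Term V) (hX : X ∈ termVars t)
      (ht : t ≠ .var X) (h : Equation.term (.var X) t ∈ E) :
      MMStep (.eqs E) .occurCheck

/-- `E` is not subject to occur-check: no execution of the algorithm starting with `E` performs
action (6). -/
def NSTO (E : Set (Equation L V)) : Prop :=
  ¬ Relation.ReflTransGen MMStep (MMConfig.eqs E) MMConfig.occurCheck

/-! ### SLD-resolution -/

/-- `Q'` is the resolvent of `Q` and the input clause `C` (variable disjoint from `Q`), where the
atom at position `i` (counted from `0`) of `Q` is selected and the mgu `θ` is used. -/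
def IsResolventWith (Q : Query L V) (i : ℕ) (C : Clause L V) (θ : Subst L V) (Q' : Query L V) :
    Prop :=
  Disjoint (Query.vars Q) C.vars ∧
    ∃ (Q₁ : Query L V) (A : Atom L V) (Q₂ : Query L V),
      Q = Q₁ ++ A :: Q₂ ∧ Q₁.length = i ∧ θ.IsMGU A C.head ∧
        Q' = Query.subst (Q₁ ++ C.body ++ Q₂) θ.toFun

/-- `Q'` is an SLD-resolvent of `Q` and `C`: it is obtained by selecting some atom of `Q` and
using some mgu and some variant of `C` that is variable disjoint from `Q`. -/
def IsSLDResolvent (Q : Query L V) (C : Clause L V) (Q' : Query L V) : Prop :=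
  ∃ (i : ℕ) (C' : Clause L V) (θ : Subst L V), C'.IsVariant C ∧ IsResolventWith Q i C' θ Q'

/-- The data of one resolution step. -/
structure Step (L : FirstOrder.Language.{u, v}) (V : Type w) where
  /-- position of the selected atom -/
  pos : ℕ
  /-- the clause of the program -/
  source : Clause L V
  /-- the input clause, a variant of `source` -/
  input : Clause L V
  mgu : Subst L V
  /-- the resulting query -/
  result : Query L V

/-- The last query of the initial fragment of a derivation that starts with `Q₀` and consists of
the steps `D`. -/
def lastQuery (Q₀ : Query L V) (D : List (Step L V)) : Query L V :=
  (D.getLast?.map Step.result).getD Q₀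

/-- `C` is standardized apart with respect to a fragment: it shares no variable with the initial
query or with the substitutions and input clauses of the earlier steps. -/
def StandardizedApart (Q₀ : Query L V) (D : List (Step L V)) (C : Clause L V) : Prop :=
  Disjoint C.vars (Query.vars Q₀) ∧
    ∀ s ∈ D, Disjoint C.vars s.mgu.vars ∧ Disjoint C.vars s.input.vars

/-- A selection rule: given an initial fragment of a derivation, it selects an atom
of the last query (by its position). It may be partial (`none`: no atom is selected). -/
structure SelectionRule (L : FirstOrder.Language.{u, v}) (V : Type w) where
  select : Query L V → List (Step L V) → Option ℕ
  valid : ∀ Q₀ D i, select Q₀ D = some i → i < (lastQuery Q₀ D).length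

/-- `s` is a resolution step, via the rule `R` and with a clause of `P`, which extends the
fragment `D`. -/
def IsStep (P : Program L V) (R : SelectionRule L V) (Q₀ : Query L V) (D : List (Step L V))
    (s : Step L V) : Prop :=
  R.select Q₀ D = some s.pos ∧ s.source ∈ P ∧ s.input.IsVariant s.source ∧
    StandardizedApart Q₀ D s.input ∧
    IsResolventWith (lastQuery Q₀ D) s.pos s.input s.mgu s.result

/-- A (finite or infinite) SLD-derivation for `P` and `Q₀` via `R`: a maximal sequence of steps. -/
structure IsSLDDerivation (P : Program L V) (R : SelectionRule L V) (Q₀ : Query L V)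
    (D : Stream'.Seq (Step L V)) : Prop where
  step : ∀ n s, D.get? n = some s → IsStep P R Q₀ (D.take n) s
  maximal : ∀ n, D.TerminatedAt n → ¬ ∃ s, IsStep P R Q₀ (D.take n) s

/-- An SLD-tree for `P` and `Q₀` via `R`. A node is given by the sequence of the steps on the path
from the root to it. Each node has exactly one child for each clause of `P` applicable to its
selected atom, and no other children. -/
structure IsSLDTree (P : Program L V) (R : SelectionRule L V) (Q₀ : Query L V)
    (T : Set (List (Step L V))) : Prop where
  root : [] ∈ T
  parent : ∀ D s, D ++ [s] ∈ T → D ∈ T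
  step : ∀ D s, D ++ [s] ∈ T → IsStep P R Q₀ D s
  children : ∀ D ∈ T, ∀ C ∈ P, (∃ s, IsStep P R Q₀ D s ∧ s.source = C) →
    ∃! s, D ++ [s] ∈ T ∧ s.source = C

/-- The unification of `A` and `H` is available at the last query of the fragment `D`: `A` is the
atom selected there, and `H`, with the same predicate symbol, is the head of a standardized apart
variant of a clause of `P`. -/
def AvailableAt (P : Program L V) (R : SelectionRule L V) (Q₀ : Query L V) (D : List (Step L V))
    (A H : Atom L V) : Prop :=
  (∃ i, R.select Q₀ D = some i ∧ (lastQuery Q₀ D)[i]? = some A) ∧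
    (∃ C ∈ P, ∃ C' : Clause L V, C'.IsVariant C ∧ StandardizedApart Q₀ D C' ∧ C'.head = H) ∧
    (⟨A.arity, A.pred⟩ : Σ k, L.Relations k) = ⟨H.arity, H.pred⟩

/-- All unifications available in the derivation `D` are NSTO. -/
def DerivationOccurCheckFree (P : Program L V) (R : SelectionRule L V) (Q₀ : Query L V)
    (D : Stream'.Seq (Step L V)) : Prop :=
  ∀ n A H, AvailableAt P R Q₀ (D.take n) A H → NSTO {Equation.atom A H}

/-- All unifications available in the tree `T` are NSTO. -/
def TreeOccurCheckFree (P : Program L V) (R : SelectionRule L V) (Q₀ : Query L V)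
    (T : Set (List (Step L V))) : Prop :=
  ∀ D ∈ T, ∀ A H, AvailableAt P R Q₀ D A H → NSTO {Equation.atom A H}

/-- `P` with `Q₀` is occur-check free under `R`: every SLD-tree, and every SLD-derivation, for `P`
and `Q₀` via `R` is occur-check free. -/
def OccurCheckFree (P : Program L V) (R : SelectionRule L V) (Q₀ : Query L V) : Prop :=
  (∀ T, IsSLDTree P R Q₀ T → TreeOccurCheckFree P R Q₀ T) ∧
    ∀ D, IsSLDDerivation P R Q₀ D → DerivationOccurCheckFree P R Q₀ D

/-! ### Modes and tidiness -/

/-- `input` is written `+`, `output` is written `-`. -/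
inductive Mode
  | input
  | output
  deriving DecidableEq

/-- A moding assigns a mode to each argument position of each predicate symbol. -/
abbrev Moding (L : FirstOrder.Language.{u, v}) := ∀ n : ℕ, L.Relations n → Fin n → Mode

/-- The variable occurrences in the argument positions of `A` which have the mode `d`. -/
def Atom.occs (m : Moding L) (d : Mode) (A : Atom L V) : List V :=
  ((List.finRange A.arity).filter fun i => m A.arity A.pred i = d).flatMap
    fun i => termOccs (A.args i)

def Atom.varIn (m : Moding L) (A : Atom L V) : Set V := {x | x ∈ A.occs m .input}

def Atom.varOut (m : Moding L) (A : Atom L V) : Set V := {x | x ∈ A.occs m .output}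

def Atom.InputLinear (m : Moding L) (A : Atom L V) : Prop := (A.occs m .input).Nodup

/-- No variable occurs more than once in the output positions of `Q`. -/
def Query.OutputLinear (m : Moding L) (Q : Query L V) : Prop :=
  (Q.flatMap fun A => A.occs m .output).Nodup

/-- The relation `A →_Q B` on the atoms of `Q`. -/
def Query.Rel (m : Moding L) (Q : Query L V) (A B : Atom L V) : Prop :=
  A ∈ Q ∧ B ∈ Q ∧ ∃ x, x ∈ A.varOut m ∧ x ∈ B.varIn m

def Query.Tidy (m : Moding L) (Q : Query L V) : Prop :=
  Query.OutputLinear m Q ∧ ∀ A ∈ Q, ¬ Relation.TransGen (Query.Rel m Q) A A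

def Clause.Tidy (m : Moding L) (C : Clause L V) : Prop :=
  Query.Tidy m C.body ∧ C.head.InputLinear m ∧
    ∀ x ∈ C.head.varIn m, ∀ B ∈ C.body, x ∉ B.varOut m

def Program.Tidy (m : Moding L) (P : Program L V) : Prop := ∀ C ∈ P, C.Tidy m

end LP

namespace LP

universe u v w

variable {L : FirstOrder.Language.{u, v}} {V : Type w}

open FirstOrder.Language (Term)

/-! ### Nicely moded sequences of variable occurrences -/

/-- `a` may precede `b`, where `a` and `b` list the input and the output occurrences of variables:
no output variable of `b` occurs in `a`. -/
def MayPrecede (a b : List V × List V) : Prop := a.2.Disjoint b.2 ∧ a.1.Disjoint b.2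

/-- No variable occurs twice in output position, and no output variable of an item occurs in an
input position of this item or of an earlier one. -/
def NicelyModed (F : List (List V × List V)) : Prop :=
  (∀ a ∈ F, a.2.Nodup ∧ a.1.Disjoint a.2) ∧ F.Pairwise MayPrecede

/-- Replace each occurrence of `x` by the list `g x`. -/
def replaceOccs (g : V → List V) (a : List V × List V) : List V × List V :=
  (a.1.flatMap g, a.2.flatMap g)

theorem NicelyModed.sublist {F G : List (List V × List V)} (h : G.Sublist F)
    (hF : NicelyModed F) : NicelyModed G :=
  ⟨fun a ha => hF.1 a (h.subset ha), hF.2.sublist h⟩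

theorem NicelyModed.nodup_outputs {F : List (List V × List V)} (hF : NicelyModed F) :
    (F.flatMap Prod.snd).Nodup :=
  List.nodup_flatMap.2 ⟨fun a ha => (hF.1 a ha).1, hF.2.imp fun h => h.1⟩

/-- Splitting an item into parts keeps a sequence nicely moded. -/
theorem NicelyModed.split {F₁ F₂ G : List (List V × List V)}
    (h : NicelyModed (F₁ ++ (G.flatMap Prod.fst, G.flatMap Prod.snd) :: F₂)) :
    NicelyModed (F₁ ++ G ++ F₂) := by
  obtain ⟨h1, h2⟩ := h
  simp only [List.pairwise_append, List.pairwise_cons, MayPrecede, List.mem_append,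
    List.mem_cons, List.Disjoint, List.mem_flatMap] at h1 h2
  have hG := h1 _ (Or.inr (Or.inl rfl))
  rw [List.nodup_flatMap] at hG
  obtain ⟨⟨hG1, hG2⟩, hG3⟩ := hG
  simp only [List.mem_flatMap] at hG3
  refine ⟨?_, ?_⟩
  · intro a ha
    simp only [List.mem_append] at ha
    rcases ha with (ha | ha) | ha
    · exact h1 a (Or.inl ha)
    · exact ⟨hG1 a ha, fun x hx hx' => hG3 ⟨a, ha, hx⟩ ⟨a, ha, hx'⟩⟩
    · exact h1 a (Or.inr (Or.inr ha))
  · have hGG : G.Pairwise MayPrecede :=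
      hG2.imp_of_mem fun {a b} ha hb h =>
        ⟨h, fun x hx hx' => hG3 ⟨a, ha, hx⟩ ⟨b, hb, hx'⟩⟩
    simp only [List.pairwise_append, MayPrecede, List.mem_append, List.Disjoint]
    refine ⟨⟨h2.1, hGG, ?_⟩, h2.2.1.2, ?_⟩
    · intro a ha b hb
      have := h2.2.2 a ha _ (Or.inl rfl)
      exact ⟨fun x hx hx' => this.1 hx (List.mem_flatMap.2 ⟨b, hb, hx'⟩),
        fun x hx hx' => this.2 hx (List.mem_flatMap.2 ⟨b, hb, hx'⟩)⟩
    · rintro a (ha | ha) b hb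
      · exact h2.2.2 a ha b (Or.inr hb)
      · have := h2.2.1.1 b hb
        exact ⟨fun x hx hx' => this.1 ⟨a, ha, hx⟩ hx', fun x hx hx' => this.2 ⟨a, ha, hx⟩ hx'⟩

/-- Replacing distinct variables by disjoint linear lists keeps a sequence nicely moded. -/
theorem NicelyModed.replace {F : List (List V × List V)} (hF : NicelyModed F) {S : Set V}
    (hS : ∀ a ∈ F, ∀ x, x ∈ a.1 ∨ x ∈ a.2 → x ∈ S) {g : V → List V}
    (hg : ∀ x ∈ S, (g x).Nodup)
    (hgd : ∀ x ∈ S, ∀ y ∈ S, ∀ z, z ∈ g x → z ∈ g y → x = y) :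
    NicelyModed (F.map (replaceOccs g)) := by
  have key : ∀ l l' : List V, (∀ x ∈ l, x ∈ S) → (∀ x ∈ l', x ∈ S) → l.Disjoint l' →
      (l.flatMap g).Disjoint (l'.flatMap g) := by
    intro l l' hl hl' hd z hz hz'
    obtain ⟨x, hx, hzx⟩ := List.mem_flatMap.1 hz
    obtain ⟨y, hy, hzy⟩ := List.mem_flatMap.1 hz'
    obtain rfl := hgd x (hl x hx) y (hl' y hy) z hzx hzy
    exact hd hx hy
  have hS1 : ∀ a ∈ F, ∀ x ∈ a.1, x ∈ S := fun a ha x hx => hS a ha x (Or.inl hx)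
  have hS2 : ∀ a ∈ F, ∀ x ∈ a.2, x ∈ S := fun a ha x hx => hS a ha x (Or.inr hx)
  refine ⟨?_, ?_⟩
  · intro b hb
    obtain ⟨a, ha, rfl⟩ := List.mem_map.1 hb
    refine ⟨List.nodup_flatMap.2 ⟨fun x hx => hg x (hS2 a ha x hx), ?_⟩,
      key _ _ (hS1 a ha) (hS2 a ha) (hF.1 a ha).2⟩
    refine List.Pairwise.imp_of_mem (fun {x y} hx hy hxy z hz hz' => hxy ?_) (hF.1 a ha).1
    exact hgd x (hS2 a ha x hx) y (hS2 a ha y hy) z hz hz'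
  · rw [List.pairwise_map]
    exact hF.2.imp_of_mem fun {a b} ha hb h =>
      ⟨key _ _ (hS2 a ha) (hS2 b hb) h.1, key _ _ (hS1 a ha) (hS2 b hb) h.2⟩

theorem mem_flatMap_elim {g : V → List V} {X : V} (hg : ∀ y, y ≠ X → g y = [y]) (l : List V)
    (y : V) : y ∈ l.flatMap g ↔ (y ∈ l ∧ y ≠ X) ∨ (X ∈ l ∧ y ∈ g X) := by
  rw [List.mem_flatMap]
  constructor
  · rintro ⟨x, hx, hy⟩
    by_cases h : x = X
    · subst h; exact Or.inr ⟨hx, hy⟩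
    · rw [hg x h, List.mem_singleton] at hy
      subst hy; exact Or.inl ⟨hx, h⟩
  · rintro (⟨h, hy⟩ | ⟨h, hy⟩)
    · exact ⟨y, h, by simp [hg y hy]⟩
    · exact ⟨X, h, hy⟩

theorem nodup_flatMap_elim {g : V → List V} {X : V} (hg : ∀ y, y ≠ X → g y = [y]) {l : List V}
    (hl : l.Nodup) (h : X ∈ l → (g X).Nodup ∧ (g X).Disjoint l) : (l.flatMap g).Nodup := by
  refine List.nodup_flatMap.2 ⟨fun x hx => ?_, List.Pairwise.imp_of_mem ?_ hl⟩
  · by_cases hxX : x = X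
    · subst hxX; exact (h hx).1
    · simp [hg x hxX]
  · intro x y hx hy hxy z hz hz'
    by_cases hxX : x = X
    · subst hxX
      rw [hg y (Ne.symm hxy), List.mem_singleton] at hz'
      subst hz'; exact (h hx).2 hz hy
    · rw [hg x hxX, List.mem_singleton] at hz
      subst hz
      by_cases hyX : y = X
      · subst hyX; exact (h hy).2 hz' hx
      · rw [hg y hyX, List.mem_singleton] at hz'
        exact hxy hz'

theorem flatMap_eq_self {g : V → List V} {X : V} (hg : ∀ y, y ≠ X → g y = [y]) {l : List V}
    (h : X ∉ l) : l.flatMap g = l := by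
  induction l with
  | nil => rfl
  | cons y l ih =>
    simp only [List.mem_cons, not_or] at h
    rw [List.flatMap_cons, ih h.2, hg y (Ne.symm h.1), List.singleton_append]

theorem disjoint_flatMap_elim {g : V → List V} {X : V} (hg : ∀ y, y ≠ X → g y = [y])
    {l l' : List V} (h : l.Disjoint l') (h₁ : X ∈ l → (g X).Disjoint l')
    (h₂ : X ∈ l' → (g X).Disjoint l) : (l.flatMap g).Disjoint (l'.flatMap g) := by
  intro y hy hy'
  rw [mem_flatMap_elim hg] at hy hy'
  rcases hy with ⟨hy, -⟩ | ⟨hX, hy⟩ <;> rcases hy' with ⟨hy', -⟩ | ⟨hX', hy'⟩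
  · exact h hy hy'
  · exact h₂ hX' hy' hy
  · exact h₁ hX hy hy'
  · exact h hX hX'

/-- Elimination of `X`, where `X` is the output of an item. -/
theorem NicelyModed.elim_output {F₁ F₂ : List (List V × List V)} {X : V} {g : V → List V}
    (hg : ∀ y, y ≠ X → g y = [y]) (h : NicelyModed (F₁ ++ (g X, [X]) :: F₂)) :
    NicelyModed (F₁.map (replaceOccs g) ++ (g X, [X]) :: F₂.map (replaceOccs g)) := by
  obtain ⟨h1, h2⟩ := h
  simp only [List.pairwise_append, List.pairwise_cons, List.forall_mem_append,
    List.forall_mem_cons] at h1 h2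
  obtain ⟨h11, hp, h12⟩ := h1
  obtain ⟨h21, ⟨hp2, h22⟩, h12'⟩ := h2
  have hF₁ : F₁.map (replaceOccs g) = F₁ := by
    refine (List.map_congr_left fun a ha => ?_).trans (List.map_id F₁)
    have := (h12' a ha).1
    exact Prod.ext (flatMap_eq_self hg fun hX => this.2 hX (by simp))
      (flatMap_eq_self hg fun hX => this.1 hX (by simp))
  have hX2 : ∀ a ∈ F₂, X ∉ a.2 := fun a ha hX => (hp2 a ha).1 (by simp) hX
  have hfm : ∀ a ∈ F₂, a.2.flatMap g = a.2 := fun a ha => flatMap_eq_self hg (hX2 a ha)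
  have hdis : ∀ a : List V × List V, ∀ b ∈ F₂, a.1.Disjoint b.2 → (a.1.flatMap g).Disjoint (b.2.flatMap g) :=
    fun a b hb hab => disjoint_flatMap_elim hg hab (fun _ => (hp2 b hb).2)
      fun hX => (hX2 b hb hX).elim
  rw [hF₁, NicelyModed]
  simp only [List.pairwise_append, List.pairwise_cons, List.forall_mem_append,
    List.forall_mem_cons, List.forall_mem_map, List.pairwise_map, replaceOccs, MayPrecede]
  refine ⟨⟨h11, hp, fun a ha => ⟨by rw [hfm a ha]; exact (h12 a ha).1, hdis a a ha (h12 a ha).2⟩⟩,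
    h21, ⟨fun a ha => by rw [hfm a ha]; exact hp2 a ha, h22.imp_of_mem fun {a b} ha hb hab =>
      ⟨by rw [hfm a ha, hfm b hb]; exact hab.1, hdis a b hb hab.2⟩⟩, fun a ha =>
      ⟨(h12' a ha).1, fun b hb => by rw [hfm b hb]; exact (h12' a ha).2 b hb⟩⟩

/-- Elimination of `X`, where `X` is the input of an item. -/
theorem NicelyModed.elim_input {F₁ F₂ : List (List V × List V)} {X : V} {g : V → List V}
    (hg : ∀ y, y ≠ X → g y = [y]) (h : NicelyModed (F₁ ++ ([X], g X) :: F₂)) :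
    NicelyModed (F₁.map (replaceOccs g) ++ (g X, [X]) :: F₂.map (replaceOccs g)) := by
  obtain ⟨h1, h2⟩ := h
  simp only [List.pairwise_append, List.pairwise_cons, List.forall_mem_append,
    List.forall_mem_cons] at h1 h2
  obtain ⟨h11, hp, h12⟩ := h1
  obtain ⟨h21, ⟨hp2, h22⟩, h12'⟩ := h2
  have hXX : X ∉ g X := fun hX => hp.2 (by simp) hX
  have hX2 : ∀ a ∈ F₂, X ∉ a.2 := fun a ha hX => (hp2 a ha).2 (by simp) hX
  have hfm : ∀ a ∈ F₂, a.2.flatMap g = a.2 := fun a ha => flatMap_eq_self hg (hX2 a ha)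
  have hno : ∀ l : List V, X ∉ l.flatMap g := fun l hX => by
    rw [mem_flatMap_elim hg] at hX
    exact hX.elim (fun h => h.2 rfl) fun h => hXX h.2
  have hd1 : ∀ a ∈ F₁, (g X).Disjoint a.1 ∧ (g X).Disjoint a.2 := fun a ha =>
    ⟨(h12' a ha).1.2.symm, (h12' a ha).1.1.symm⟩
  have hd2 : ∀ b ∈ F₂, (g X).Disjoint b.2 := fun b hb => (hp2 b hb).1
  rw [NicelyModed]
  simp only [List.pairwise_append, List.pairwise_cons, List.forall_mem_append,
    List.forall_mem_cons, List.forall_mem_map, List.pairwise_map, replaceOccs, MayPrecede,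
    List.disjoint_singleton, List.singleton_disjoint]
  refine ⟨⟨fun a ha => ⟨nodup_flatMap_elim hg (h11 a ha).1 fun _ => ⟨hp.1, (hd1 a ha).2⟩,
      disjoint_flatMap_elim hg (h11 a ha).2 (fun _ => (hd1 a ha).2) fun _ => (hd1 a ha).1⟩,
    ⟨List.nodup_singleton X, hXX⟩, fun b hb => ⟨by rw [hfm b hb]; exact (h12 b hb).1,
      disjoint_flatMap_elim hg (h12 b hb).2 (fun _ => hd2 b hb) fun hX => (hX2 b hb hX).elim⟩⟩,
    h21.imp_of_mem fun {a b} ha hb hab =>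
      ⟨disjoint_flatMap_elim hg hab.1 (fun _ => (hd1 b hb).2) fun _ => (hd1 a ha).2,
       disjoint_flatMap_elim hg hab.2 (fun _ => (hd1 b hb).2) fun _ => (hd1 a ha).1⟩,
    ⟨fun b hb => ⟨hno _, by rw [hfm b hb]; exact hd2 b hb⟩, h22.imp_of_mem fun {a b} ha hb hab =>
      ⟨disjoint_flatMap_elim hg hab.1 (fun _ => hd2 b hb) fun hX => (hX2 b hb hX).elim,
       disjoint_flatMap_elim hg hab.2 (fun _ => hd2 b hb) fun hX => (hX2 b hb hX).elim⟩⟩,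
    fun a ha => ⟨⟨hno _, hno _⟩, fun b hb => ?_⟩⟩
  have hab := (h12' a ha).2 b hb
  exact ⟨disjoint_flatMap_elim hg hab.1 (fun _ => hd2 b hb) fun hX => (hX2 b hb hX).elim,
    disjoint_flatMap_elim hg hab.2 (fun _ => hd2 b hb) fun hX => (hX2 b hb hX).elim⟩

theorem NicelyModed.elim {F₁ F₂ : List (List V × List V)} {X : V} {g : V → List V}
    (hg : ∀ y, y ≠ X → g y = [y]) {a : List V × List V} (ha : a = ([X], g X) ∨ a = (g X, [X]))
    (h : NicelyModed (F₁ ++ a :: F₂)) :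
    NicelyModed (F₁.map (replaceOccs g) ++ (g X, [X]) :: F₂.map (replaceOccs g)) := by
  rcases ha with rfl | rfl
  · exact h.elim_input hg
  · exact h.elim_output hg

/-- Combination of a query, with items `R₁, (i, o), R₂`, and of a variable disjoint clause, with
head inputs `i'`, head outputs `o'` and body `B`: the unification of the selected atom with the
head is represented by the items `(i, i')` and `(o', o)`. -/
theorem NicelyModed.combine {R₁ R₂ B : List (List V × List V)} {i o i' o' : List V}
    (hR : NicelyModed (R₁ ++ (i, o) :: R₂)) (hB : NicelyModed (([], i') :: B)) {S T : Set V}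
    (hST : Disjoint S T) (hS : ∀ a ∈ R₁ ++ (i, o) :: R₂, ∀ x, x ∈ a.1 ∨ x ∈ a.2 → x ∈ S)
    (hT : ∀ a ∈ (o', i') :: B, ∀ x, x ∈ a.1 ∨ x ∈ a.2 → x ∈ T) :
    NicelyModed (R₁ ++ (i, i') :: (B ++ (o', o) :: R₂)) := by
  have hd : ∀ l l' : List V, (∀ x ∈ l, x ∈ S) → (∀ x ∈ l', x ∈ T) → l.Disjoint l' :=
    fun l l' hl hl' x hx hx' => Set.disjoint_left.1 hST (hl x hx) (hl' x hx')
  have hS1 : ∀ a ∈ R₁ ++ (i, o) :: R₂, ∀ x ∈ a.1, x ∈ S := fun a ha x hx => hS a ha x (Or.inl hx)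
  have hS2 : ∀ a ∈ R₁ ++ (i, o) :: R₂, ∀ x ∈ a.2, x ∈ S := fun a ha x hx => hS a ha x (Or.inr hx)
  have hT1 : ∀ a ∈ (o', i') :: B, ∀ x ∈ a.1, x ∈ T := fun a ha x hx => hT a ha x (Or.inl hx)
  have hT2 : ∀ a ∈ (o', i') :: B, ∀ x ∈ a.2, x ∈ T := fun a ha x hx => hT a ha x (Or.inr hx)
  obtain ⟨hR1, hR2⟩ := hR
  obtain ⟨hB1, hB2⟩ := hB
  simp only [List.pairwise_append, List.pairwise_cons, List.forall_mem_append,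
    List.forall_mem_cons, MayPrecede] at hR1 hR2 hB1 hB2 hS1 hS2 hT1 hT2
  simp only [NicelyModed, List.pairwise_append, List.pairwise_cons, List.forall_mem_append,
    List.forall_mem_cons, MayPrecede]
  refine ⟨⟨hR1.1, ⟨hB1.1.1, hd _ _ hS1.2.1 hT2.1⟩, hB1.2,
    ⟨hR1.2.1.1, (hd _ _ hS2.2.1 hT1.1).symm⟩, hR1.2.2⟩, hR2.1, ⟨⟨fun b hb => ?_, ?_, fun b hb => ?_⟩,
    hB2.2, ⟨fun b hb => ?_, hR2.2.1.2⟩, fun b hb => ⟨?_, fun c hc => ?_⟩⟩,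
    fun a ha => ⟨?_, fun b hb => ?_, ?_, fun b hb => ?_⟩⟩
  · exact ⟨(hB2.1 b hb).1, hd _ _ hS1.2.1 (hT2.2 b hb)⟩
  · exact ⟨(hd _ _ hS2.2.1 hT2.1).symm, hR1.2.1.2⟩
  · exact ⟨(hd _ _ (hS2.2.2 b hb) hT2.1).symm, (hR2.2.1.1 b hb).2⟩
  · exact ⟨(hR2.2.1.1 b hb).1, (hd _ _ (hS2.2.2 b hb) hT1.1).symm⟩
  · exact ⟨(hd _ _ hS2.2.1 (hT2.2 b hb)).symm, (hd _ _ hS2.2.1 (hT1.2 b hb)).symm⟩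
  · exact ⟨(hd _ _ (hS2.2.2 c hc) (hT2.2 b hb)).symm, (hd _ _ (hS2.2.2 c hc) (hT1.2 b hb)).symm⟩
  · exact ⟨hd _ _ (hS2.1 a ha) hT2.1, hd _ _ (hS1.1 a ha) hT2.1⟩
  · exact ⟨hd _ _ (hS2.1 a ha) (hT2.2 b hb), hd _ _ (hS1.1 a ha) (hT2.2 b hb)⟩
  · exact (hR2.2.2 a ha).1
  · exact (hR2.2.2 a ha).2 b hb

/-! ### Terms and substitutions -/

theorem termOccs_subst (f : V → L.Term V) (t : L.Term V) :
    termOccs (t.subst f) = (termOccs t).flatMap fun x => termOccs (f x) := by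
  induction t with
  | var x => simp [termOccs, Term.subst]
  | func F ts ih =>
    simp only [Term.subst, termOccs, ih, ← List.flatMap_id, List.flatMap_assoc]
    simp [List.flatMap_def, List.map_ofFn, Function.comp_def]

theorem subst_subst (f g : V → L.Term V) (t : L.Term V) :
    (t.subst f).subst g = t.subst fun x => (f x).subst g := by
  induction t with
  | var x => rfl
  | func F ts ih => simp only [Term.subst, ih]

theorem subst_var (t : L.Term V) : t.subst Term.var = t := by
  induction t with
  | var x => rfl
  | func F ts ih => simp only [Term.subst, ih]

theorem mem_termOccs_func {n : ℕ} {F : L.Functions n} {ts : Fin n → L.Term V} {x : V} :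
    x ∈ termOccs (Term.func F ts) ↔ ∃ i, x ∈ termOccs (ts i) := by
  simp [termOccs, List.mem_flatten, List.mem_ofFn]

theorem func_eq_iff {n k : ℕ} {F : L.Functions n} {G : L.Functions k} {s : Fin n → L.Term V}
    {t : Fin k → L.Term V} (h : Term.func F s = Term.func G t) :
    ∃ e : n = k, e ▸ F = G ∧ ∀ i, s i = t (Fin.cast e i) := by
  rw [Term.func.injEq] at h
  obtain ⟨rfl, h1, h2⟩ := h
  exact ⟨rfl, eq_of_heq h1, congrFun (eq_of_heq h2)⟩

theorem subst_eq_subst_iff {f g : V → L.Term V} {t : L.Term V} :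
    t.subst f = t.subst g ↔ ∀ x ∈ termOccs t, f x = g x := by
  induction t with
  | var x => simp [termOccs, Term.subst]
  | func F ts ih =>
    simp only [mem_termOccs_func]
    constructor
    · rintro h x ⟨i, hx⟩
      obtain ⟨_, _, h'⟩ := func_eq_iff h
      exact (ih i).1 (h' i) x hx
    · intro h
      simp only [Term.subst]
      congr 1
      funext i
      exact (ih i).2 fun x hx => h x ⟨i, hx⟩

/-- The number of variable and function symbol occurrences. -/
def termSize : L.Term V → ℕ
  | .var _ => 1
  | .func _ ts => 1 + ∑ i, termSize (ts i)

theorem termSize_pos (t : L.Term V) : 0 < termSize t := by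
  cases t <;> simp [termSize]

def Subst.id : Subst L V := ⟨Term.var, by simp⟩

def Subst.comp (θ σ : Subst L V) : Subst L V :=
  ⟨fun x => (θ.toFun x).subst σ.toFun, by
    refine (θ.finite_dom.union σ.finite_dom).subset fun x hx => ?_
    by_contra h
    simp only [Set.mem_union, Set.mem_ofPred_eq, not_or, not_not] at h
    exact hx (by rw [h.1]; exact h.2)⟩

noncomputable def Subst.single (X : V) (t : L.Term V) : Subst L V :=
  ⟨singleSubst X t, by
    refine (Set.finite_singleton X).subset fun x hx => ?_
    by_contra h
    exact hx (if_neg h)⟩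

theorem Subst.single_comp_toFun (X : V) (t : L.Term V) (θ : Subst L V) :
    ((Subst.single X t).comp θ).toFun = fun x => (singleSubst X t x).subst θ.toFun := rfl

theorem singleSubst_self (X : V) (t : L.Term V) : singleSubst X t X = t := if_pos rfl

theorem singleSubst_of_ne {X y : V} (h : y ≠ X) (t : L.Term V) : singleSubst X t y = .var y :=
  if_neg h

theorem termOccs_singleSubst_of_ne {X y : V} (h : y ≠ X) (t : L.Term V) :
    termOccs (singleSubst X t y) = [y] := by
  rw [singleSubst_of_ne h]; rfl

theorem subst_singleSubst_of_notMem {X : V} {t u : L.Term V} (h : X ∉ termOccs u) :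
    u.subst (singleSubst X t) = u := by
  conv_rhs => rw [← subst_var u]
  exact subst_eq_subst_iff.2 fun x hx => singleSubst_of_ne (by rintro rfl; exact h hx) t

theorem subst_singleSubst_subst {X : V} {t : L.Term V} {σ : V → L.Term V}
    (h : σ X = t.subst σ) (u : L.Term V) : (u.subst (singleSubst X t)).subst σ = u.subst σ := by
  rw [subst_subst]
  refine subst_eq_subst_iff.2 fun x _ => ?_
  by_cases hx : x = X
  · rw [hx, singleSubst_self, h]
  · rw [singleSubst_of_ne hx]; rfl

/-! ### Items of atoms and of oriented equations -/

/-- The input and the output occurrences of an atom. -/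
def Atom.item (m : Moding L) (A : Atom L V) : List V × List V := (A.occs m .input, A.occs m .output)

theorem Atom.occs_subst (m : Moding L) (d : Mode) (A : Atom L V) (f : V → L.Term V) :
    (A.subst f).occs m d = (A.occs m d).flatMap fun x => termOccs (f x) := by
  simp only [Atom.occs, Atom.subst, List.flatMap_assoc, termOccs_subst]
  rfl

theorem Atom.item_subst (m : Moding L) (A : Atom L V) (f : V → L.Term V) :
    (A.subst f).item m = replaceOccs (fun x => termOccs (f x)) (A.item m) := by
  simp only [Atom.item, replaceOccs, Atom.occs_subst]

theorem Atom.subst_subst (A : Atom L V) (f g : V → L.Term V) :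
    (A.subst f).subst g = A.subst fun x => (f x).subst g := by
  simp only [Atom.subst, LP.subst_subst]

theorem Atom.subst_var (A : Atom L V) : A.subst Term.var = A := by
  simp only [Atom.subst, LP.subst_var]

theorem Atom.mem_vars_of_mem_item {m : Moding L} {A : Atom L V} {x : V}
    (h : x ∈ (A.item m).1 ∨ x ∈ (A.item m).2) : x ∈ A.vars := by
  simp only [Atom.item, Atom.occs, List.mem_flatMap] at h
  rcases h with ⟨i, -, hi⟩ | ⟨i, -, hi⟩ <;> exact ⟨i, hi⟩

/-- An equation between terms, together with the information whether the left-hand side or the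
right-hand side is regarded as its input. -/
structure OrientedEq (L : FirstOrder.Language.{u, v}) (V : Type w) where
  inputLeft : Bool
  lhs : L.Term V
  rhs : L.Term V

def OrientedEq.item (e : OrientedEq L V) : List V × List V :=
  bif e.inputLeft then (termOccs e.lhs, termOccs e.rhs) else (termOccs e.rhs, termOccs e.lhs)

def OrientedEq.subst (e : OrientedEq L V) (f : V → L.Term V) : OrientedEq L V :=
  ⟨e.inputLeft, e.lhs.subst f, e.rhs.subst f⟩

theorem OrientedEq.item_subst (e : OrientedEq L V) (f : V → L.Term V) :
    (e.subst f).item = replaceOccs (fun x => termOccs (f x)) e.item := by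
  obtain ⟨b, s, t⟩ := e
  cases b <;> simp only [item, subst, replaceOccs, termOccs_subst, cond_true, cond_false]

theorem OrientedEq.item_func (b : Bool) {n : ℕ} (F : L.Functions n) (s t : Fin n → L.Term V) :
    OrientedEq.item ⟨b, .func F s, .func F t⟩ =
      (((List.ofFn fun i => OrientedEq.mk b (s i) (t i)).map item).flatMap Prod.fst,
        ((List.ofFn fun i => OrientedEq.mk b (s i) (t i)).map item).flatMap Prod.snd) := by
  cases b <;> simp [item, termOccs, List.flatMap_def, List.map_ofFn, Function.comp_def]

/-- `σ` makes both sides of the equation equal. -/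
def OrientedEq.UnifiedBy (e : OrientedEq L V) (σ : V → L.Term V) : Prop :=
  e.lhs.subst σ = e.rhs.subst σ

/-- An equation to be solved or an atom to be instantiated by the solution. -/
abbrev Goal (L : FirstOrder.Language.{u, v}) (V : Type w) := OrientedEq L V ⊕ Atom L V

def Goal.item (m : Moding L) : Goal L V → List V × List V :=
  Sum.elim OrientedEq.item (Atom.item m)

def Goal.subst (f : V → L.Term V) : Goal L V → Goal L V :=
  Sum.map (fun e => e.subst f) fun A => A.subst f

theorem Goal.item_subst (m : Moding L) (c : Goal L V) (f : V → L.Term V) :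
    Goal.item m (c.subst f) = replaceOccs (fun x => termOccs (f x)) (c.item m) := by
  cases c
  · exact OrientedEq.item_subst _ f
  · exact Atom.item_subst m _ f

theorem Goal.map_item_subst (m : Moding L) (F : List (Goal L V)) (f : V → L.Term V) :
    (F.map (Goal.subst f)).map (Goal.item m) =
      (F.map (Goal.item m)).map (replaceOccs fun x => termOccs (f x)) := by
  simp only [List.map_map, Function.comp_def, Goal.item_subst]

/-- The atoms among the goals. -/
def atomsOf (F : List (Goal L V)) : List (Atom L V) := F.filterMap Sum.getRight?

theorem atomsOf_cons_inl (e : OrientedEq L V) (F : List (Goal L V)) :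
    atomsOf (Sum.inl e :: F) = atomsOf F := rfl

theorem atomsOf_append (F G : List (Goal L V)) : atomsOf (F ++ G) = atomsOf F ++ atomsOf G :=
  List.filterMap_append

theorem atomsOf_map_inl (F : List (OrientedEq L V)) : atomsOf (F.map Sum.inl) = [] := by
  simp [atomsOf, List.filterMap_map, Function.comp_def]

theorem atomsOf_map_inr (F : List (Atom L V)) : atomsOf (F.map Sum.inr) = F := by
  simp [atomsOf, List.filterMap_map, Function.comp_def]

theorem atomsOf_map_subst (F : List (Goal L V)) (f : V → L.Term V) :
    atomsOf (F.map (Goal.subst f)) = (atomsOf F).map fun A => A.subst f := by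
  induction F with
  | nil => rfl
  | cons c F ih =>
    cases c with
    | inl e => exact ih
    | inr A => exact congrArg (A.subst f :: ·) ih

theorem map_item_atomsOf_sublist (m : Moding L) (F : List (Goal L V)) :
    ((atomsOf F).map (Atom.item m)).Sublist (F.map (Goal.item m)) := by
  induction F with
  | nil => exact List.Sublist.refl _
  | cons c F ih =>
    cases c with
    | inl e => exact ih.cons _
    | inr A => exact ih.cons_cons _

/-! ### Solving a nicely moded sequence of equations -/

/-- The size of the instance of the left-hand side of an equation. -/
def Goal.weight (η : V → L.Term V) : Goal L V → ℕ :=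
  Sum.elim (fun e => termSize (e.lhs.subst η)) fun _ => 0

/-- `θ` is a most general solution of the equations of `F` and keeps the atoms nicely moded. -/
def IsNiceSolution (m : Moding L) (F : List (Goal L V)) (θ : Subst L V) : Prop :=
  (∀ e, Sum.inl e ∈ F → e.UnifiedBy θ.toFun) ∧
    (∀ σ : V → L.Term V, (∀ e, Sum.inl e ∈ F → e.UnifiedBy σ) →
      ∀ x, σ x = (θ.toFun x).subst σ) ∧
    NicelyModed ((Query.subst (atomsOf F) θ.toFun).map (Atom.item m))

theorem isNiceSolution_of_elim {m : Moding L} {F₁ F₂ : List (Goal L V)} {e : OrientedEq L V}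
    {X : V} {t : L.Term V} (hX : X ∉ termOccs t)
    (he : ∀ σ : V → L.Term V, e.UnifiedBy σ ↔ σ X = t.subst σ) {θ : Subst L V}
    (hθ : IsNiceSolution m ((F₁ ++ F₂).map (Goal.subst (singleSubst X t))) θ) :
    IsNiceSolution m (F₁ ++ Sum.inl e :: F₂) ((Subst.single X t).comp θ) := by
  obtain ⟨h1, h2, h3⟩ := hθ
  refine ⟨fun e' he' => ?_, fun σ hσ x => ?_, ?_⟩
  · have : Sum.inl e' ∈ F₁ ++ F₂ ∨ e' = e := by
      simp only [List.mem_append, List.mem_cons, Sum.inl.injEq] at he' ⊢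
      tauto
    rcases this with h | rfl
    · have := h1 _ (List.mem_map.2 ⟨_, h, rfl⟩)
      simpa only [OrientedEq.UnifiedBy, OrientedEq.subst, subst_subst,
        Subst.single_comp_toFun] using this
    · rw [he]
      change (singleSubst X t X).subst θ.toFun = t.subst fun x => (singleSubst X t x).subst θ.toFun
      rw [singleSubst_self, ← subst_subst, subst_singleSubst_of_notMem hX]
  · have hσX : σ X = t.subst σ := (he σ).1 (hσ e (by simp))
    have h2' := h2 σ ?_
    · change σ x = ((singleSubst X t x).subst θ.toFun).subst σ
      rw [subst_subst, ← funext h2']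
      exact (subst_singleSubst_subst hσX (.var x)).symm
    · intro e' he'
      obtain ⟨c, hc, hce⟩ := List.mem_map.1 he'
      cases c with
      | inr A => cases hce
      | inl c =>
        cases hce
        have := hσ c (by simp only [List.mem_append, List.mem_cons] at hc ⊢; tauto)
        simpa only [OrientedEq.UnifiedBy, OrientedEq.subst, subst_singleSubst_subst hσX] using this
  · rw [atomsOf_map_subst] at h3
    have : atomsOf (F₁ ++ Sum.inl e :: F₂) = atomsOf (F₁ ++ F₂) := by
      rw [atomsOf_append, atomsOf_append, atomsOf_cons_inl]
    rw [this]
    simpa only [Subst.single_comp_toFun, Query.subst, List.map_map, Function.comp_def, Atom.subst_subst] using h3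

theorem exists_isNiceSolution (m : Moding L) (η : V → L.Term V) (n : ℕ) (F : List (Goal L V))
    (hF : NicelyModed (F.map (Goal.item m))) (hη : ∀ e, Sum.inl e ∈ F → e.UnifiedBy η)
    (hn : (F.map (Goal.weight η)).sum = n) : ∃ θ : Subst L V, IsNiceSolution m F θ := by
  induction n using Nat.strong_induction_on generalizing F with
  | _ n ih =>
  by_cases hex : ∃ e, Sum.inl e ∈ F
  swap
  · push Not at hex
    refine ⟨Subst.id, fun e he => (hex e he).elim, fun σ _ x => rfl, ?_⟩
    have : Query.subst (atomsOf F) (Subst.id (L := L)).toFun = atomsOf F := by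
      simp only [Query.subst, Subst.id, Atom.subst_var, List.map_id']
    rw [this]
    exact hF.sublist (map_item_atomsOf_sublist m F)
  obtain ⟨e, he⟩ := hex
  obtain ⟨F₁, F₂, rfl⟩ := List.append_of_mem he
  have heη := hη e he
  have hF' := hF
  rw [List.map_append, List.map_cons] at hF'
  have hsum : n = ((F₁ ++ F₂).map (Goal.weight η)).sum + termSize (e.lhs.subst η) := by
    rw [← hn]
    simp only [List.map_append, List.map_cons, List.sum_append, List.sum_cons]
    simp only [Goal.weight, Sum.elim_inl]
    omega
  have hdis : e.item.1.Disjoint e.item.2 := (hF'.1 (Goal.item m (Sum.inl e)) (by simp)).2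
  have elim : ∀ (X : V) (t : L.Term V),
      (∀ σ : V → L.Term V, e.UnifiedBy σ ↔ σ X = t.subst σ) →
      (e.item = ([X], termOccs t) ∨ e.item = (termOccs t, [X])) →
      ∃ θ : Subst L V, IsNiceSolution m (F₁ ++ Sum.inl e :: F₂) θ := by
    intro X t hu hitem
    have hX : X ∉ termOccs t := by
      intro hX
      rcases hitem with h | h <;> rw [h] at hdis
      · exact hdis (by simp) hX
      · exact hdis hX (by simp)
    have hηX := (hu η).1 heη
    have hsol := ih (((F₁ ++ F₂).map (Goal.subst (singleSubst X t))).map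
        (Goal.weight η)).sum ?_ ((F₁ ++ F₂).map (Goal.subst (singleSubst X t))) ?_ ?_ rfl
    · obtain ⟨θ, hθ⟩ := hsol
      exact ⟨_, isNiceSolution_of_elim hX hu hθ⟩
    · have : ((F₁ ++ F₂).map (Goal.subst (singleSubst X t))).map (Goal.weight η) =
          (F₁ ++ F₂).map (Goal.weight η) := by
        rw [List.map_map]
        refine List.map_congr_left fun c _ => ?_
        cases c with
        | inl c =>
          simp only [Function.comp, Goal.weight, Goal.subst, Sum.map_inl, Sum.elim_inl,
            OrientedEq.subst, subst_singleSubst_subst hηX]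
        | inr c => rfl
      rw [this, hsum]
      have := termSize_pos (e.lhs.subst η)
      omega
    · have := NicelyModed.elim (g := fun x => termOccs (singleSubst X t x))
        (fun y hy => termOccs_singleSubst_of_ne hy t) (a := e.item)
        (by simpa only [singleSubst_self] using hitem) hF'
      rw [Goal.map_item_subst, List.map_append, List.map_append]
      exact this.sublist (List.Sublist.append (List.Sublist.refl _) (List.sublist_cons_self _ _))
    · intro e' he'
      obtain ⟨c, hc, hce⟩ := List.mem_map.1 he'
      cases c with
      | inr A => cases hce
      | inl c =>
        cases hce
        have := hη c (by simp only [List.mem_append, List.mem_cons] at hc ⊢; tauto)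
        simpa only [OrientedEq.UnifiedBy, OrientedEq.subst, subst_singleSubst_subst hηX] using this
  obtain ⟨b, s, t⟩ := e
  cases s with
  | var X =>
    exact elim X t (fun σ => Iff.rfl) (by cases b <;> simp [OrientedEq.item, termOccs])
  | func f s =>
    cases t with
    | var X =>
      exact elim X (.func f s) (fun σ => eq_comm)
        (by cases b <;> simp [OrientedEq.item, termOccs])
    | func g t =>
      obtain ⟨rfl, hfg, hst⟩ := func_eq_iff heη
      obtain rfl : f = g := hfg
      set G := List.ofFn fun i => OrientedEq.mk b (s i) (t i) with hG
      have hmem : ∀ e, e ∈ G ↔ ∃ i, OrientedEq.mk b (s i) (t i) = e := fun e => by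
        rw [hG, List.mem_ofFn]
      have hiff : ∀ σ : V → L.Term V,
          (∀ e, Sum.inl e ∈ F₁ ++ G.map Sum.inl ++ F₂ → e.UnifiedBy σ) ↔
            ∀ e, Sum.inl e ∈ F₁ ++ Sum.inl ⟨b, .func f s, .func f t⟩ :: F₂ → e.UnifiedBy σ := by
        intro σ
        have : (∀ i, (s i).subst σ = (t i).subst σ) ↔
            (Term.func f s).subst σ = (Term.func f t).subst σ := by
          constructor
          · intro h; simp only [Term.subst, h]
          · intro h; obtain ⟨_, _, h'⟩ := func_eq_iff h; exact h'
        simp only [List.mem_append, List.mem_cons, List.mem_map, Sum.inl.injEq,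
          exists_eq_right, hmem]
        constructor
        · rintro h e (he | rfl | he)
          · exact h e (Or.inl (Or.inl he))
          · exact this.1 fun i => h _ (Or.inl (Or.inr ⟨i, rfl⟩))
          · exact h e (Or.inr he)
        · rintro h e ((he | ⟨i, rfl⟩) | he)
          · exact h e (Or.inl he)
          · exact this.2 (h _ (Or.inr (Or.inl rfl))) i
          · exact h e (Or.inr (Or.inr he))
      have hsol := ih ((F₁ ++ G.map Sum.inl ++ F₂).map (Goal.weight η)).sum ?_
        (F₁ ++ G.map Sum.inl ++ F₂) ?_ ((hiff η).2 hη) rfl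
      · obtain ⟨θ, h1, h2, h3⟩ := hsol
        refine ⟨θ, (hiff _).1 h1, fun σ hσ => h2 σ ((hiff σ).2 hσ), ?_⟩
        rw [atomsOf_append, atomsOf_append, atomsOf_map_inl, List.append_nil,
          ← atomsOf_append] at h3
        have : atomsOf (F₁ ++ Sum.inl ⟨b, .func f s, .func f t⟩ :: F₂) = atomsOf (F₁ ++ F₂) := by
          rw [atomsOf_append, atomsOf_append, atomsOf_cons_inl]
        rwa [this]
      · have : (G.map (Goal.weight η ∘ Sum.inl)).sum = ∑ i, termSize ((s i).subst η) := by
          rw [hG, List.map_ofFn, List.sum_ofFn]; rfl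
        rw [hsum]
        simp only [List.map_append, List.map_map, List.sum_append, this, Term.subst, termSize]
        omega
      · rw [List.map_append, List.map_append, List.map_map]
        refine NicelyModed.split (G := G.map OrientedEq.item) ?_
        rw [hG, ← OrientedEq.item_func]
        exact hF'

/-! ### Tidy queries and clauses -/

theorem Query.Tidy.exists_perm {m : Moding L} {Q : Query L V} (h : Query.Tidy m Q) :
    ∃ Q' : Query L V, Q'.Perm Q ∧ NicelyModed (Q'.map (Atom.item m)) := by
  classical
  obtain ⟨hlin, hacyc⟩ := h
  have hacyc' : ∀ A, ¬ Relation.TransGen (Query.Rel m Q) A A := fun A hA => by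
    obtain ⟨B, hAB, -⟩ := Relation.TransGen.head'_iff.1 hA
    exact hacyc A hAB.1 hA
  have : IsPartialOrder (Atom L V) (Relation.ReflTransGen (Query.Rel m Q)) :=
    { refl := fun _ => Relation.ReflTransGen.refl
      trans := fun _ _ _ => Relation.ReflTransGen.trans
      antisymm := fun A B hAB hBA => by
        rcases Relation.reflTransGen_iff_eq_or_transGen.1 hAB with h | h
        · exact h.symm
        · exact (hacyc' A (h.trans_left hBA)).elim }
  obtain ⟨s, hs, hle⟩ := extend_partialOrder (Relation.ReflTransGen (Query.Rel m Q))
  have hperm := List.perm_insertionSort s Q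
  have hsorted := List.pairwise_insertionSort s Q
  refine ⟨Q.insertionSort s, hperm, ?_, ?_⟩
  all_goals
    have hlin' : ((Q.insertionSort s).flatMap fun A => A.occs m .output).Nodup :=
      (hperm.flatMap_right _).nodup_iff.2 hlin
    rw [List.nodup_flatMap] at hlin'
  · simp only [List.forall_mem_map]
    refine fun A hA => ⟨hlin'.1 A hA, fun x hx hx' => hacyc' A (.single ?_)⟩
    exact ⟨hperm.mem_iff.1 hA, hperm.mem_iff.1 hA, x, hx', hx⟩
  · rw [List.pairwise_map]
    refine (hsorted.and hlin'.2).imp_of_mem fun {A B} hA hB h => ⟨h.2, fun x hx hx' => ?_⟩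
    have hBA : Query.Rel m Q B A := ⟨hperm.mem_iff.1 hB, hperm.mem_iff.1 hA, x, hx', hx⟩
    obtain rfl : A = B := antisymm_of s h.1 (hle _ _ (.single hBA))
    exact hacyc' A (.single hBA)

theorem Query.tidy_of_perm {m : Moding L} {Q Q' : Query L V} (hperm : Q'.Perm Q)
    (h : NicelyModed (Q'.map (Atom.item m))) : Query.Tidy m Q := by
  classical
  constructor
  · have := h.nodup_outputs
    rw [List.flatMap_map] at this
    exact (hperm.flatMap_right _).nodup_iff.1 this
  · intro A _ hA
    have key : ∀ A B, Query.Rel m Q A B → Q'.idxOf A < Q'.idxOf B := by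
      rintro A B ⟨hA, hB, x, hxA, hxB⟩
      rw [← hperm.mem_iff] at hA hB
      by_contra hlt
      rw [not_lt] at hlt
      rcases hlt.eq_or_lt with heq | hlt
      · obtain rfl := (List.idxOf_inj hB).1 heq
        exact (h.1 _ (List.mem_map_of_mem hA)).2 hxB hxA
      · have h2 := List.pairwise_iff_getElem.1 (List.pairwise_map.1 h.2) _ _
          (List.idxOf_lt_length_iff.2 hB) (List.idxOf_lt_length_iff.2 hA) hlt
        rw [List.getElem_idxOf, List.getElem_idxOf] at h2
        exact h2.2 hxB hxA
    have : ∀ A B, Relation.TransGen (Query.Rel m Q) A B → Q'.idxOf A < Q'.idxOf B := by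
      intro A B hAB
      induction hAB with
      | single h => exact key _ _ h
      | tail _ h ih => exact ih.trans (key _ _ h)
    exact lt_irrefl _ (this A A hA)

theorem Clause.Tidy.exists_perm {m : Moding L} {C : Clause L V} (h : C.Tidy m) :
    ∃ B : Query L V, B.Perm C.body ∧
      NicelyModed (([], C.head.occs m .input) :: B.map (Atom.item m)) := by
  obtain ⟨hb, hl, hd⟩ := h
  obtain ⟨B, hB, hn⟩ := hb.exists_perm
  refine ⟨B, hB, ?_, List.pairwise_cons.2 ⟨?_, hn.2⟩⟩
  · rw [List.forall_mem_cons]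
    exact ⟨⟨hl, List.disjoint_nil_left _⟩, hn.1⟩
  · rw [List.forall_mem_map]
    exact fun A hA => ⟨fun x hx hx' => hd x hx A (hB.mem_iff.1 hA) hx', List.disjoint_nil_left _⟩

/-- The nicely moded arrangement of a variant of a tidy clause. -/
theorem Clause.Tidy.exists_perm_of_isVariant {m : Moding L} {C C' : Clause L V} (h : C.Tidy m)
    (hC : C'.IsVariant C) :
    ∃ B : Query L V, B.Perm C'.body ∧
      NicelyModed (([], C'.head.occs m .input) :: B.map (Atom.item m)) := by
  obtain ⟨γ, ⟨π, hπ⟩, rfl⟩ := hC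
  obtain ⟨B, hB, hn⟩ := h.exists_perm
  refine ⟨Query.subst B γ.toFun, hB.map _, ?_⟩
  have := hn.replace (S := Set.univ) (fun _ _ _ _ => Set.mem_univ _)
    (g := fun x => termOccs (γ.toFun x)) (fun x _ => by simp [hπ, termOccs])
    (fun x _ y _ z hz hz' => by
      rw [hπ, termOccs, List.mem_singleton] at hz hz'
      exact π.injective (hz.symm.trans hz'))
  simpa only [List.map_cons, replaceOccs, List.flatMap_nil, Clause.subst, Atom.occs_subst,
    Query.subst, List.map_map, Function.comp_def, Atom.item] using this

/-! ### Unification of an atom with a clause head -/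

/-- The equations between the arguments of two atoms at the positions of one mode, in which the
input side is `s` for input positions and `t` for output positions. -/
def argEqs (m : Moding L) (d : Mode) {n : ℕ} (p : L.Relations n) (s t : Fin n → L.Term V) :
    List (OrientedEq L V) :=
  ((List.finRange n).filter fun i => m n p i = d).map
    fun i => ⟨decide (d = .input), s i, t i⟩

theorem mem_argEqs {m : Moding L} {d : Mode} {n : ℕ} {p : L.Relations n} {s t : Fin n → L.Term V}
    {e : OrientedEq L V} :
    e ∈ argEqs m d p s t ↔ ∃ i, m n p i = d ∧ ⟨decide (d = .input), s i, t i⟩ = e := by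
  simp [argEqs]

theorem NicelyModed.argEqs_input {m : Moding L} {n : ℕ} {p : L.Relations n}
    {s t : Fin n → L.Term V} {F₁ F₂ : List (List V × List V)}
    (h : NicelyModed (F₁ ++
      (Atom.occs m .input ⟨n, p, s⟩, Atom.occs m .input ⟨n, p, t⟩) :: F₂)) :
    NicelyModed (F₁ ++ (argEqs m .input p s t).map OrientedEq.item ++ F₂) := by
  apply NicelyModed.split
  simpa only [Atom.occs, argEqs, List.flatMap_map, OrientedEq.item, decide_true, cond_true] using h

theorem NicelyModed.argEqs_output {m : Moding L} {n : ℕ} {p : L.Relations n}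
    {s t : Fin n → L.Term V} {F₁ F₂ : List (List V × List V)}
    (h : NicelyModed (F₁ ++
      (Atom.occs m .output ⟨n, p, t⟩, Atom.occs m .output ⟨n, p, s⟩) :: F₂)) :
    NicelyModed (F₁ ++ (argEqs m .output p s t).map OrientedEq.item ++ F₂) := by
  apply NicelyModed.split
  simpa only [Atom.occs, argEqs, List.flatMap_map, OrientedEq.item, reduceCtorEq, decide_false,
    cond_false] using h

theorem atom_ext_pred {A H : Atom L V}
    (h : (⟨A.arity, A.pred⟩ : Σ k, L.Relations k) = ⟨H.arity, H.pred⟩) :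
    ∃ t : Fin A.arity → L.Term V, H = ⟨A.arity, A.pred, t⟩ := by
  obtain ⟨n, p, s⟩ := A
  obtain ⟨k, q, t⟩ := H
  cases h
  exact ⟨t, rfl⟩

theorem atom_subst_eq_iff {n : ℕ} {p : L.Relations n} {s t : Fin n → L.Term V}
    {f : V → L.Term V} :
    Atom.subst ⟨n, p, s⟩ f = Atom.subst ⟨n, p, t⟩ f ↔ ∀ i, (s i).subst f = (t i).subst f := by
  simp [Atom.subst, funext_iff]

theorem Subst.Unifies.pred_eq {θ : Subst L V} {A H : Atom L V} (h : θ.Unifies A H) :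
    (⟨A.arity, A.pred⟩ : Σ k, L.Relations k) = ⟨H.arity, H.pred⟩ := by
  obtain ⟨n, p, s⟩ := A
  obtain ⟨k, q, t⟩ := H
  simp only [Subst.Unifies, Atom.subst, Atom.mk.injEq] at h
  obtain ⟨rfl, h, -⟩ := h
  cases h
  rfl

/-- All most general unifiers differ by renamings only, hence they preserve tidiness if one of
them does. -/
theorem NicelyModed.of_isMGU {m : Moding L} {A H : Atom L V} {θ θ₀ : Subst L V}
    (hθ : θ.IsMGU A H) (hθ₀ : θ₀.Unifies A H)
    (hgen : ∀ x, θ.toFun x = (θ₀.toFun x).subst θ.toFun) {Q : Query L V}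
    (h : NicelyModed ((Query.subst Q θ₀.toFun).map (Atom.item m))) :
    NicelyModed ((Query.subst Q θ.toFun).map (Atom.item m)) := by
  obtain ⟨γ, hγ⟩ := hθ.2 θ₀ hθ₀
  have hinv : ∀ x, ∀ y ∈ termOccs (θ₀.toFun x), (θ.toFun y).subst γ.toFun = .var y := by
    intro x
    have : (θ₀.toFun x).subst (fun y => (θ.toFun y).subst γ.toFun) =
        (θ₀.toFun x).subst Term.var := by
      rw [← subst_subst, ← hgen, ← hγ, subst_var]
    exact subst_eq_subst_iff.1 this
  have hvar : ∀ t : L.Term V, ∀ y, t.subst γ.toFun = .var y →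
      ∃ z, t = .var z ∧ γ.toFun z = .var y := by
    intro t y ht
    cases t with
    | var z => exact ⟨z, rfl, ht⟩
    | func => cases ht
  have := h.replace (S := {y | ∃ x, y ∈ termOccs (θ₀.toFun x)}) ?_
    (g := fun x => termOccs (θ.toFun x)) ?_ ?_
  · have hA : ∀ A : Atom L V, A.subst θ.toFun = (A.subst θ₀.toFun).subst θ.toFun := fun A => by
      rw [Atom.subst_subst, ← funext hgen]
    simpa only [Query.subst, List.map_map, Function.comp_def, ← Atom.item_subst, ← hA] using this
  · simp only [Query.subst, List.map_map, List.forall_mem_map, Function.comp_def,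
      Atom.item_subst, replaceOccs, List.mem_flatMap]
    rintro A - x (⟨y, -, hy⟩ | ⟨y, -, hy⟩) <;> exact ⟨y, hy⟩
  · rintro y ⟨x, hy⟩
    obtain ⟨z, hz, -⟩ := hvar _ _ (hinv x y hy)
    rw [hz]
    exact List.nodup_singleton z
  · rintro y ⟨x, hy⟩ y' ⟨x', hy'⟩ w hw hw'
    obtain ⟨z, hz, hzy⟩ := hvar _ _ (hinv x y hy)
    obtain ⟨z', hz', hzy'⟩ := hvar _ _ (hinv x' y' hy')
    rw [hz, termOccs, List.mem_singleton] at hw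
    rw [hz', termOccs, List.mem_singleton] at hw'
    rw [← hw, hw', hzy', Term.var.injEq] at hzy
    exact hzy.symm

theorem mem_vars_of_item_mem_map {m : Moding L} {Q : Query L V} {a : List V × List V}
    (ha : a ∈ Q.map (Atom.item m)) {x : V} (hx : x ∈ a.1 ∨ x ∈ a.2) : x ∈ Query.vars Q := by
  obtain ⟨A, hA, rfl⟩ := List.mem_map.1 ha
  exact ⟨A, hA, Atom.mem_vars_of_mem_item hx⟩

theorem Query.vars_perm {Q Q' : Query L V} (h : Q.Perm Q') : Query.vars Q = Query.vars Q' := by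
  simp only [Query.vars, h.mem_iff]

/-- The items that represent the unification of a selected atom with a clause head. -/
theorem NicelyModed.combine_clause {m : Moding L} {R₁ R₂ B : Query L V} {A : Atom L V}
    {C : Clause L V} (hR : NicelyModed ((R₁ ++ A :: R₂).map (Atom.item m)))
    (hB : NicelyModed (([], C.head.occs m .input) :: B.map (Atom.item m)))
    (hBC : B.Perm C.body) (hd : Disjoint (Query.vars (R₁ ++ A :: R₂)) C.vars) :
    NicelyModed (R₁.map (Atom.item m) ++ (A.occs m .input, C.head.occs m .input) ::
      (B.map (Atom.item m) ++ (C.head.occs m .output, A.occs m .output) ::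
        R₂.map (Atom.item m))) := by
  rw [List.map_append, List.map_cons] at hR
  refine NicelyModed.combine hR hB hd ?_ ?_
  · intro a ha x hx
    have ha' : a ∈ (R₁ ++ A :: R₂).map (Atom.item m) := by
      rw [List.map_append, List.map_cons]
      exact ha
    exact mem_vars_of_item_mem_map ha' hx
  · rw [List.forall_mem_cons]
    refine ⟨fun x hx => Or.inl (Atom.mem_vars_of_mem_item (m := m) hx.symm), fun a ha x hx => ?_⟩
    exact Or.inr (Query.vars_perm hBC ▸ mem_vars_of_item_mem_map ha hx)

theorem Query.Tidy.resolvent {m : Moding L} {Q Q' : Query L V} {i : ℕ} {C C' : Clause L V}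
    {θ : Subst L V} (hQ : Query.Tidy m Q) (hC : C.Tidy m) (hC' : C'.IsVariant C)
    (h : IsResolventWith Q i C' θ Q') : Query.Tidy m Q' := by
  obtain ⟨hd, Q₁, A, Q₂, rfl, -, hθ, rfl⟩ := h
  obtain ⟨R, hR, hRn⟩ := hQ.exists_perm
  obtain ⟨B, hB, hBn⟩ := hC.exists_perm_of_isVariant hC'
  obtain ⟨R₁, R₂, rfl⟩ := List.append_of_mem (hR.mem_iff.2 (by simp : A ∈ Q₁ ++ A :: Q₂))
  rw [← Query.vars_perm hR] at hd
  have hn := hRn.combine_clause hBn hB hd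
  have hperm : (R₁ ++ B ++ R₂).Perm (Q₁ ++ C'.body ++ Q₂) := by
    have h1 : (R₁ ++ R₂).Perm (Q₁ ++ Q₂) :=
      List.Perm.cons_inv (List.perm_middle.symm.trans (hR.trans List.perm_middle))
    calc (R₁ ++ B ++ R₂).Perm (B ++ (R₁ ++ R₂)) := by
          rw [← List.append_assoc]; exact List.perm_append_comm.append_right _
      _ |>.Perm (C'.body ++ (Q₁ ++ Q₂)) := hB.append h1
      _ |>.Perm (Q₁ ++ C'.body ++ Q₂) := by
          rw [← List.append_assoc]; exact List.perm_append_comm.append_right _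
  obtain ⟨t, ht⟩ := atom_ext_pred hθ.1.pred_eq
  obtain ⟨H, body⟩ := C'
  obtain ⟨n, p, s⟩ := A
  obtain rfl : H = ⟨n, p, t⟩ := ht
  have hn' := hn.argEqs_input
  rw [← List.append_assoc] at hn'
  have hn'' := hn'.argEqs_output
  set E₁ := argEqs m .input p s t with hE₁
  set E₂ := argEqs m .output p s t with hE₂
  let F : List (Goal L V) := R₁.map Sum.inr ++ E₁.map Sum.inl ++ B.map Sum.inr ++
    E₂.map Sum.inl ++ R₂.map Sum.inr
  have hF : NicelyModed (F.map (Goal.item m)) := by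
    simp only [F, List.map_append, List.map_map]
    exact hn''
  have hmem : ∀ σ : V → L.Term V, (∀ e, Sum.inl e ∈ F → e.UnifiedBy σ) ↔
      ∀ i, (s i).subst σ = (t i).subst σ := by
    intro σ
    simp only [F, List.mem_append, List.mem_map, reduceCtorEq, and_false, exists_false, false_or,
      or_false, Sum.inl.injEq, exists_eq_right, hE₁, hE₂, mem_argEqs]
    constructor
    · intro h i
      cases hi : m n p i
      · exact h _ (Or.inl ⟨i, hi, rfl⟩)
      · exact h _ (Or.inr ⟨i, hi, rfl⟩)
    · rintro h e (⟨i, -, rfl⟩ | ⟨i, -, rfl⟩) <;> exact h i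
  have hθu := (hmem θ.toFun).2 (atom_subst_eq_iff.1 hθ.1)
  obtain ⟨θ₀, h1, h2, h3⟩ := exists_isNiceSolution m θ.toFun _ F hF hθu rfl
  have hatoms : atomsOf F = R₁ ++ B ++ R₂ := by
    simp only [F, atomsOf_append, atomsOf_map_inl, atomsOf_map_inr, List.append_nil]
  rw [hatoms] at h3
  refine Query.tidy_of_perm (hperm.map _) (NicelyModed.of_isMGU hθ ?_ (h2 _ hθu) h3)
  exact atom_subst_eq_iff.2 ((hmem _).1 h1)

/-! ### NSTO -/

/-- The equation set is covered by a nicely moded sequence of oriented equations. -/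
def NicelyCovered (E : Set (Equation L V)) : Prop :=
  ∃ F : List (OrientedEq L V), NicelyModed (F.map OrientedEq.item) ∧
    ∀ e ∈ E, ∃ o ∈ F, e = .term o.lhs o.rhs

theorem NicelyCovered.mono {E E' : Set (Equation L V)} (h : NicelyCovered E) (hE : E' ⊆ E) :
    NicelyCovered E' := by
  obtain ⟨F, hF, hc⟩ := h
  exact ⟨F, hF, fun e he => hc e (hE he)⟩

/-- The other equations are covered by the other members of the sequence. -/
theorem NicelyCovered.exists_split {E : Set (Equation L V)} (h : NicelyCovered E)
    {s t : L.Term V} (hst : Equation.term s t ∈ E) :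
    ∃ (F₁ F₂ : List (OrientedEq L V)) (b : Bool),
      NicelyModed (F₁.map OrientedEq.item ++
        OrientedEq.item ⟨b, s, t⟩ :: F₂.map OrientedEq.item) ∧
      ∀ e ∈ E \ {Equation.term s t}, ∃ o, (o ∈ F₁ ∨ o ∈ F₂) ∧ e = .term o.lhs o.rhs := by
  obtain ⟨F, hF, hc⟩ := h
  obtain ⟨⟨b, s', t'⟩, ho, hoe⟩ := hc _ hst
  cases hoe
  obtain ⟨F₁, F₂, rfl⟩ := List.append_of_mem ho
  refine ⟨F₁, F₂, b, by simpa only [List.map_append, List.map_cons] using hF, ?_⟩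
  rintro e ⟨he, hne⟩
  obtain ⟨o, ho, rfl⟩ := hc e he
  refine ⟨o, ?_, rfl⟩
  rcases List.mem_append.1 ho with h | h
  · exact Or.inl h
  · rcases List.mem_cons.1 h with rfl | h
    · exact (hne rfl).elim
    · exact Or.inr h

/-- Nicely covered equation sets stay nicely covered and never fail by the occur-check. -/
theorem MMStep.nicelyCovered {E : Set (Equation L V)} {c : MMConfig L V}
    (h : MMStep (.eqs E) c) (hE : NicelyCovered E) :
    c = .clash ∨ ∃ E', c = .eqs E' ∧ NicelyCovered E' := by
  cases h with
  | decompose_term f s t h =>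
    refine Or.inr ⟨_, rfl, ?_⟩
    obtain ⟨F₁, F₂, b, hn, hc⟩ := hE.exists_split h
    refine ⟨F₁ ++ (List.ofFn fun i => OrientedEq.mk b (s i) (t i)) ++ F₂, ?_, ?_⟩
    · rw [OrientedEq.item_func] at hn
      rw [List.map_append, List.map_append]
      exact hn.split
    · rintro e (he | ⟨i, rfl⟩)
      · obtain ⟨o, ho, rfl⟩ := hc e he
        exact ⟨o, by simp only [List.mem_append]; tauto, rfl⟩
      · refine ⟨⟨b, s i, t i⟩, ?_, rfl⟩
        exact List.mem_append_left _ (List.mem_append_right _ (List.mem_ofFn.2 ⟨i, rfl⟩))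
  | decompose_atom p s t h =>
    obtain ⟨F, -, hc⟩ := hE
    obtain ⟨o, -, ho⟩ := hc _ h
    cases ho
  | clash_term => exact Or.inl rfl
  | clash_atom => exact Or.inl rfl
  | delete X h => exact Or.inr ⟨_, rfl, hE.mono Set.sdiff_subset⟩
  | swap X t ht h =>
    refine Or.inr ⟨_, rfl, ?_⟩
    obtain ⟨F₁, F₂, b, hn, hc⟩ := hE.exists_split h
    refine ⟨F₁ ++ ⟨!b, .var X, t⟩ :: F₂, ?_, ?_⟩
    · rw [List.map_append, List.map_cons]
      cases b <;> exact hn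
    · rintro e (he | rfl)
      · obtain ⟨o, ho, rfl⟩ := hc e he
        exact ⟨o, by simp only [List.mem_append, List.mem_cons]; tauto, rfl⟩
      · exact ⟨⟨!b, .var X, t⟩, by simp, rfl⟩
  | eliminate X t hX h helse =>
    refine Or.inr ⟨_, rfl, ?_⟩
    obtain ⟨F₁, F₂, b, hn, hc⟩ := hE.exists_split h
    have hn' := hn.elim (g := fun x => termOccs (singleSubst X t x))
      (fun y hy => termOccs_singleSubst_of_ne hy t)
      (by rw [singleSubst_self]; cases b <;> simp [OrientedEq.item, termOccs])
    rw [singleSubst_self] at hn'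
    refine ⟨F₁.map (fun o => o.subst (singleSubst X t)) ++ ⟨false, .var X, t⟩ ::
      F₂.map (fun o => o.subst (singleSubst X t)), ?_, ?_⟩
    · rw [List.map_append, List.map_cons, List.map_map, List.map_map]
      rw [List.map_map, List.map_map] at hn'
      simp only [Function.comp_def, OrientedEq.item_subst] at hn' ⊢
      exact hn'
    · rintro e (rfl | ⟨e, he, rfl⟩)
      · exact ⟨⟨false, .var X, t⟩, by simp, rfl⟩
      · obtain ⟨o, ho, rfl⟩ := hc e he
        refine ⟨o.subst (singleSubst X t), ?_, rfl⟩
        simp only [List.mem_append, List.mem_cons]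
        exact ho.imp (fun h => List.mem_map_of_mem h) fun h => Or.inr (List.mem_map_of_mem h)
  | occur_check X t hX ht h =>
    obtain ⟨F₁, F₂, b, hn, -⟩ := hE.exists_split h
    have := (hn.1 (OrientedEq.item ⟨b, .var X, t⟩) (by simp)).2
    exfalso
    cases b
    · exact this hX (List.mem_singleton_self X)
    · exact this (List.mem_singleton_self X) hX

theorem NicelyCovered.nsto {E : Set (Equation L V)} (hE : NicelyCovered E) : NSTO E := by
  intro h
  have key : ∀ c : MMConfig L V, Relation.ReflTransGen MMStep (.eqs E) c →
      c = .clash ∨ ∃ E', c = .eqs E' ∧ NicelyCovered E' := by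
    intro c h
    induction h with
    | refl => exact Or.inr ⟨E, rfl, hE⟩
    | tail _ hs ih =>
      rcases ih with rfl | ⟨E', rfl, hE'⟩
      · cases hs
      · exact hs.nicelyCovered hE'
  rcases key _ h with h | ⟨_, h, -⟩ <;> cases h

theorem nsto_singleton_atom {A H : Atom L V}
    (h : ∀ t : Fin A.arity → L.Term V, H = ⟨A.arity, A.pred, t⟩ →
      NicelyCovered (Set.range fun i => Equation.term (A.args i) (t i))) :
    NSTO {Equation.atom A H} := by
  intro hocc
  rcases Relation.ReflTransGen.cases_head hocc with h' | ⟨c, hstep, hrest⟩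
  · cases h'
  generalize hE : ({Equation.atom A H} : Set (Equation L V)) = E at hstep
  have hmem : ∀ e ∈ E, e = Equation.atom A H := by
    rw [← hE]; exact fun _ he => he
  cases hstep with
  | decompose_atom p s t h' =>
    have := hmem _ h'
    rw [Equation.atom.injEq] at this
    obtain ⟨rfl, rfl⟩ := this
    refine ((h t rfl).mono ?_).nsto hrest
    rintro e (⟨he, hne⟩ | he)
    · exact (hne (hmem e he)).elim
    · exact he
  | clash_term | clash_atom =>
    rcases Relation.ReflTransGen.cases_head hrest with h' | ⟨_, h', -⟩ <;> cases h'
  | decompose_term _ _ _ h' => cases hmem _ h'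
  | delete _ h' => cases hmem _ h'
  | swap _ _ _ h' => cases hmem _ h'
  | eliminate _ _ _ h' _ => cases hmem _ h'
  | occur_check _ _ _ _ h' => cases hmem _ h'

/-- The unification of an atom of a tidy query with the head of a variable disjoint variant of a
tidy clause is not subject to occur-check. -/
theorem Query.Tidy.nsto {m : Moding L} {Q : Query L V} (hQ : Query.Tidy m Q) {A : Atom L V}
    (hA : A ∈ Q) {C C' : Clause L V} (hC : C.Tidy m) (hC' : C'.IsVariant C)
    (hd : Disjoint (Query.vars Q) C'.vars) : NSTO {Equation.atom A C'.head} := by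
  refine nsto_singleton_atom fun t ht => ?_
  obtain ⟨R, hR, hRn⟩ := hQ.exists_perm
  obtain ⟨B, hB, hBn⟩ := hC.exists_perm_of_isVariant hC'
  obtain ⟨R₁, R₂, rfl⟩ := List.append_of_mem (hR.mem_iff.2 hA)
  rw [← Query.vars_perm hR] at hd
  have hn := hRn.combine_clause hBn hB hd
  obtain ⟨H, body⟩ := C'
  obtain ⟨n, p, s⟩ := A
  obtain rfl : H = ⟨n, p, t⟩ := ht
  have hn' := hn.argEqs_input
  rw [← List.append_assoc] at hn'
  have hn'' := hn'.argEqs_output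
  refine ⟨argEqs m .input p s t ++ argEqs m .output p s t, hn''.sublist ?_, ?_⟩
  · rw [List.map_append]
    refine List.Sublist.trans ?_ (List.sublist_append_left _ _)
    refine List.Sublist.append ?_ (List.Sublist.refl _)
    exact (List.sublist_append_right _ _).trans (List.sublist_append_left _ _)
  · rintro e ⟨i, rfl⟩
    cases hi : m n p i
    · exact ⟨_, List.mem_append_left _ (mem_argEqs.2 ⟨i, hi, rfl⟩), rfl⟩
    · exact ⟨_, List.mem_append_right _ (mem_argEqs.2 ⟨i, hi, rfl⟩), rfl⟩

/-! ### Derivations and trees -/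

/-- The initial fragments of derivations. -/
inductive IsFragment (P : Program L V) (R : SelectionRule L V) (Q₀ : Query L V) :
    List (Step L V) → Prop
  | nil : IsFragment P R Q₀ []
  | snoc {D : List (Step L V)} {s : Step L V} (hD : IsFragment P R Q₀ D)
      (hs : IsStep P R Q₀ D s) : IsFragment P R Q₀ (D ++ [s])

theorem lastQuery_append_singleton (Q₀ : Query L V) (D : List (Step L V)) (s : Step L V) :
    lastQuery Q₀ (D ++ [s]) = s.result := by
  simp [lastQuery]

theorem IsFragment.tidy_lastQuery {m : Moding L} {P : Program L V} {R : SelectionRule L V}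
    {Q₀ : Query L V} {D : List (Step L V)} (hD : IsFragment P R Q₀ D) (hP : Program.Tidy m P)
    (hQ : Query.Tidy m Q₀) : Query.Tidy m (lastQuery Q₀ D) := by
  induction hD with
  | nil => exact hQ
  | snoc _ hs ih =>
    obtain ⟨-, hsP, hvar, -, hres⟩ := hs
    rw [lastQuery_append_singleton]
    exact ih.resolvent (hP _ hsP) hvar hres

theorem mem_termOccs_or_mem_vars_of_mem_subst (θ : Subst L V) (t : L.Term V) {x : V}
    (hx : x ∈ termOccs (t.subst θ.toFun)) : x ∈ termOccs t ∨ x ∈ θ.vars := by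
  rw [termOccs_subst, List.mem_flatMap] at hx
  obtain ⟨y, hy, hxy⟩ := hx
  by_cases h : θ.toFun y = .var y
  · rw [h, termOccs, List.mem_singleton] at hxy
    exact Or.inl (hxy ▸ hy)
  · exact Or.inr (Or.inr ⟨y, h, hxy⟩)

theorem IsFragment.vars_lastQuery {P : Program L V} {R : SelectionRule L V}
    {Q₀ : Query L V} {D : List (Step L V)} (hD : IsFragment P R Q₀ D) {x : V}
    (hx : x ∈ Query.vars (lastQuery Q₀ D)) :
    x ∈ Query.vars Q₀ ∨ ∃ s ∈ D, x ∈ s.mgu.vars ∨ x ∈ s.input.vars := by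
  induction hD with
  | nil => exact Or.inl hx
  | @snoc D s _ hs ih =>
    obtain ⟨-, -, -, -, -, Q₁, A, Q₂, hlast, -, -, hres⟩ := hs
    rw [lastQuery_append_singleton, hres] at hx
    obtain ⟨B', hB', i, hi⟩ := hx
    obtain ⟨B, hB, rfl⟩ := List.mem_map.1 hB'
    rcases mem_termOccs_or_mem_vars_of_mem_subst s.mgu (B.args i) hi with hx | hx
    · have hxB : x ∈ B.vars := ⟨i, hx⟩
      rcases List.mem_append.1 hB with hB | hB
      · rcases List.mem_append.1 hB with hB | hB
        · rcases ih (hlast ▸ ⟨B, by simp [hB], hxB⟩) with h | ⟨s', hs', h⟩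
          · exact Or.inl h
          · exact Or.inr ⟨s', List.mem_append_left _ hs', h⟩
        · exact Or.inr ⟨s, by simp, Or.inr (Or.inr ⟨B, hB, hxB⟩)⟩
      · rcases ih (hlast ▸ ⟨B, by simp [hB], hxB⟩) with h | ⟨s', hs', h⟩
        · exact Or.inl h
        · exact Or.inr ⟨s', List.mem_append_left _ hs', h⟩
    · exact Or.inr ⟨s, by simp, Or.inl hx⟩

theorem IsFragment.nsto {m : Moding L} {P : Program L V} {R : SelectionRule L V}
    {Q₀ : Query L V} {D : List (Step L V)} (hD : IsFragment P R Q₀ D) (hP : Program.Tidy m P)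
    (hQ : Query.Tidy m Q₀) {A H : Atom L V} (h : AvailableAt P R Q₀ D A H) :
    NSTO {Equation.atom A H} := by
  obtain ⟨⟨i, -, hA⟩, ⟨C, hC, C', hvar, hapart, rfl⟩, -⟩ := h
  refine (hD.tidy_lastQuery hP hQ).nsto (List.mem_of_getElem? hA) (hP C hC) hvar ?_
  refine Set.disjoint_left.2 fun x hx hxC => ?_
  rcases hD.vars_lastQuery hx with h | ⟨s, hs, h | h⟩
  · exact Set.disjoint_left.1 hapart.1 hxC h
  · exact Set.disjoint_left.1 (hapart.2 s hs).1 hxC h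
  · exact Set.disjoint_left.1 (hapart.2 s hs).2 hxC h

theorem IsSLDTree.isFragment {P : Program L V} {R : SelectionRule L V} {Q₀ : Query L V}
    {T : Set (List (Step L V))} (hT : IsSLDTree P R Q₀ T) (D : List (Step L V)) (hD : D ∈ T) :
    IsFragment P R Q₀ D := by
  induction D using List.reverseRecOn with
  | nil => exact .nil
  | append_singleton D s ih => exact .snoc (ih (hT.parent D s hD)) (hT.step D s hD)

theorem seq_take_succ {α : Type*} (S : Stream'.Seq α) (n : ℕ) :
    S.take (n + 1) = S.take n ++ (S.get? n).toList := by
  induction n generalizing S with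
  | zero =>
    cases S with
    | nil => rfl
    | cons x S => rfl
  | succ n ih =>
    cases S with
    | nil => rfl
    | cons x S =>
      rw [Stream'.Seq.take_succ_cons, ih, Stream'.Seq.take_succ_cons,
        Stream'.Seq.get?_cons_succ, List.cons_append]

theorem IsSLDDerivation.isFragment {P : Program L V} {R : SelectionRule L V} {Q₀ : Query L V}
    {D : Stream'.Seq (Step L V)} (hD : IsSLDDerivation P R Q₀ D) (n : ℕ) :
    IsFragment P R Q₀ (D.take n) := by
  induction n with
  | zero => rw [Stream'.Seq.take_zero]; exact .nil
  | succ n ih =>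
    rw [seq_take_succ]
    cases h : D.get? n with
    | none => simpa using ih
    | some s => exact .snoc ih (hD.step n s h)

end LP

theorem mainTheorem2 {L : FirstOrder.Language} {V : Type*} [Infinite V] (m : LP.Moding L) :
    (∀ (P : LP.Program L V) (Q : LP.Query L V), LP.Program.Tidy m P → LP.Query.Tidy m Q →
        ∀ R : LP.SelectionRule L V, LP.OccurCheckFree P R Q) ∧
      (∀ (Q : LP.Query L V) (C : LP.Clause L V) (Q' : LP.Query L V), LP.Query.Tidy m Q →
        C.Tidy m → LP.IsSLDResolvent Q C Q' → LP.Query.Tidy m Q') := by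
  refine ⟨fun P Q hP hQ R => ⟨fun T hT D hD A H h => ?_, fun D hD n A H h => ?_⟩, ?_⟩
  · exact (hT.isFragment D hD).nsto hP hQ h
  · exact (hD.isFragment n).nsto hP hQ h
  · rintro Q C Q' hQ hC ⟨i, C', θ, hC', h⟩
    exact hQ.resolvent hC hC' h
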